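/- Let $k$ be a commutative ring with unit. Let $k\mathrm{Cat}$ be the category of small $k$-linear categories and $k$-linear functors, $S\mathrm{Mod}(k)$ the category of simplicial $k$-modules, $\mathcal U: k\mathrm{Cat}\to\mathrm{Cat}$ and $U: S\mathrm{Mod}(k)\to\mathrm{SSet}$ the forgetful functors, $N:\mathrm{Cat}\to\mathrm{SSet}$ the classical nerve, and $h:\mathrm{SSet}\to\mathrm{Cat}$ its left adjoint, the homotopy category functor. Then: 1. There is no functor $N_k: k\mathrm{Cat}\to S\mathrm{Mod}(k)$ with a natural isomorphism $U\circ N_k\cong N\circ\mathcal U$. 2. There is no functor $N_k: k\mathrm{Cat}\to S\mathrm{Mod}(k)$ with a natural isomorphism $h\circ U\circ N_k\cong h\circ N\circ\mathcal U$. Moreover, for every functor $N_k: k\mathrm{Cat}\to S\mathrm{Mod}(k)$ there is a small $k$-linear category $\mathcal C$, which can be taken non-empty if $k\neq 0$, such that the categories $hUN_k(\mathcal C)$ and $hN\mathcal U(\mathcal C)$ are not equivalent. 3. For every simplicial $k$-module $X$, the simplicial set $U(X)$ is a Kan complex. If $\mathcal C$ is a small $k$-linear category and $X$ is a simplicial $k$-module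 such that the categories $hU(X)$ and $hN\mathcal U(\mathcal C)$ are equivalent, then $\mathcal U(\mathcal C)$ is a groupoid. 4. For a small $k$-linear category $\mathcal C$, the category $\mathcal U(\mathcal C)$ is a groupoid if and only if $\mathcal C$ is trivial, that is, $\mathcal C(A,B)=0$ for all objects $A,B$ of $\mathcal C$. -/

import Mathlib

open CategoryTheory

universe u

/-- A small `k`-linear category: a small category whose hom-sets are `k`-modules and whose
composition is `k`-bilinear. -/
structure KCat (k : Type u) [CommRing k] : Type (u + 1) where
  /-- The set of objects. -/
  Obj : Type u
  [cat : Category.{u} Obj]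
  [preadditive : Preadditive Obj]
  [linear : Linear k Obj]

attribute [instance] KCat.cat KCat.preadditive KCat.linear

/-- A `k`-linear functor between small `k`-linear categories. -/
@[ext]
structure KFunctor (k : Type u) [CommRing k] (C D : KCat.{u} k) : Type u where
  /-- The underlying functor. -/
  toFunctor : C.Obj ⥤ D.Obj
  [additive : toFunctor.Additive]
  [linear : toFunctor.Linear k]

attribute [instance] KFunctor.additive KFunctor.linear

/-- The category of small `k`-linear categories and `k`-linear functors. -/
instance KCat.category (k : Type u) [CommRing k] : Category.{u} (KCat.{u} k) where
  Hom C D := KFunctor k C D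
  id C := { toFunctor := 𝟭 C.Obj }
  comp F G := { toFunctor := F.toFunctor ⋙ G.toFunctor }

/-- The forgetful functor from small `k`-linear categories to small categories. -/
def forgetKCat (k : Type u) [CommRing k] : KCat.{u} k ⥤ Cat.{u, u} where
  obj C := Cat.of C.Obj
  map F := F.toFunctor.toCatHom

/-- The forgetful functor from simplicial `k`-modules to simplicial sets, forgetting the module
structure in each simplicial degree. -/
def forgetSMod (k : Type u) [CommRing k] :
    SimplicialObject (ModuleCat.{u} k) ⥤ SSet.{u} :=
  (SimplicialObject.whiskering (ModuleCat.{u} k) (Type u)).obj (forget (ModuleCat.{u} k))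

open Simplicial Opposite

/-! Subtraction makes every edge of a simplicial module invertible up to homotopy
(`exists_compStruct_forgetSMod`), so its homotopy category is a groupoid. The homotopy category of a
nerve is the original category, and in a linear groupoid the zero endomorphisms are invertible,
which kills every hom-module. Hence `k` with one object obstructs if `k ≠ 0`; over the zero ring the
empty category does, since a simplicial module always has the vertex 0. The Kan property is
independent of this: horns are filled by Moore's method, correcting one face at a time by a
degeneracy of the error. -/

namespace CategoryTheory

namespace SimplicialObject

variable {k : Type u} [CommRing k] (X : SimplicialObject (ModuleCat.{u} k))

/-- If `z` has zero face `d_a` and `a < b`, then `s_b z` has zero face `d_a`. -/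
lemma δ_σ_eq_zero_of_lt {m : ℕ} {a b : Fin (m + 2)} (hab : a < b) {z : X _⦋m + 1⦌}
    (hz : X.δ a z = 0) : X.δ a.castSucc (X.σ b z) = 0 := by
  obtain ⟨c, rfl⟩ := Fin.exists_succ_eq.2 (Fin.ne_zero_of_lt hab)
  have h := ConcreteCategory.congr_hom (X.δ_comp_σ_of_le (Fin.le_castSucc_iff.2 hab)) z
  simpa [hz] using h

/-- If `z` has zero face `d_b` and `a < b`, then `s_a z` has zero face `d_{b + 1}`. -/
lemma δ_σ_eq_zero_of_gt {m : ℕ} {a b : Fin (m + 2)} (hab : a < b) {z : X _⦋m + 1⦌}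
    (hz : X.δ b z = 0) : X.δ b.succ (X.σ a z) = 0 := by
  obtain ⟨c, rfl⟩ := Fin.exists_castSucc_eq.2 (Fin.ne_last_of_lt hab)
  have h := ConcreteCategory.congr_hom (X.δ_comp_σ_of_gt hab) z
  simpa [hz] using h

/-! ### Moore's horn filling -/

section HornFilling

variable {X} {m : ℕ} {i : Fin (m + 3)} {y : Fin (m + 3) → X _⦋m + 1⦌}
  (hy : ∀ a b : Fin (m + 2), a ≤ b → a.castSucc ≠ i → b.succ ≠ i →
    X.δ b (y a.castSucc) = X.δ a (y b.succ))

include hy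

/-- Once `w` has one correct face, horn compatibility makes the error at another face vanish on
their common face; so a degeneracy of that error will not spoil the face already matched. -/
lemma δ_sub_eq_zero_of_le {a b : Fin (m + 2)} (hab : a ≤ b) (ha : a.castSucc ≠ i)
    (hb : b.succ ≠ i) {w : X _⦋m + 2⦌} (hw : X.δ a.castSucc w = y a.castSucc) :
    X.δ a (y b.succ - X.δ b.succ w) = 0 := by
  have h : X.δ a (X.δ b.succ w) = X.δ b (X.δ a.castSucc w) :=
    ConcreteCategory.congr_hom (X.δ_comp_δ hab) w
  rw [map_sub, h, hw, hy a b hab ha hb, sub_self]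

lemma δ_sub_eq_zero_of_ge {a b : Fin (m + 2)} (hab : a ≤ b) (ha : a.castSucc ≠ i)
    (hb : b.succ ≠ i) {w : X _⦋m + 2⦌} (hw : X.δ b.succ w = y b.succ) :
    X.δ b (y a.castSucc - X.δ a.castSucc w) = 0 := by
  have h : X.δ a (X.δ b.succ w) = X.δ b (X.δ a.castSucc w) :=
    ConcreteCategory.congr_hom (X.δ_comp_δ hab) w
  rw [map_sub, ← h, hw, hy a b hab ha hb, sub_self]

/-- In a simplicial module, the faces of a horn below the missing one can be filled. -/
lemma exists_δ_eq_of_lt (t : ℕ) (ht : t ≤ i) :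
    ∃ w : X _⦋m + 2⦌, ∀ r : Fin (m + 3), (r : ℕ) < t → X.δ r w = y r := by
  induction t with
  | zero => exact ⟨0, by simp⟩
  | succ t ih =>
    obtain ⟨w, hw⟩ := ih (by lia)
    let j : Fin (m + 2) := ⟨t, by lia⟩
    -- Face `j` of the added degeneracy is exactly the error, while its lower faces vanish.
    refine ⟨w + X.σ j (y j.castSucc - X.δ j.castSucc w), fun r hr ↦ ?_⟩
    rw [map_add]
    obtain hr | hr := Nat.lt_succ_iff_lt_or_eq.1 hr
    · obtain ⟨a, rfl⟩ := Fin.exists_castSucc_eq.2 (by grind : r ≠ Fin.last _)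
      obtain ⟨b, hb⟩ := Fin.exists_succ_eq.2
        (Fin.ne_zero_of_lt (show a.castSucc < j.castSucc from hr))
      have hz : X.δ a (y j.castSucc - X.δ j.castSucc w) = 0 := by
        rw [← hb]
        exact δ_sub_eq_zero_of_le hy (by grind) (by grind) (by grind) (hw _ hr)
      rw [hw _ hr, X.δ_σ_eq_zero_of_lt (by grind) hz, add_zero]
    · obtain rfl : r = j.castSucc := Fin.ext hr
      have h := ConcreteCategory.congr_hom (X.δ_comp_σ_self (i := j))
        (y j.castSucc - X.δ j.castSucc w)
      simp only [ConcreteCategory.comp_apply, ConcreteCategory.id_apply] at h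
      rw [h, add_sub_cancel]

/-- In a simplicial module, the faces of a horn below the missing one together with the
last `t` faces above it can be filled. -/
lemma exists_δ_eq_of_lt_or_gt (t : ℕ) :
    ∃ w : X _⦋m + 2⦌, ∀ r : Fin (m + 3), r < i ∨ (i < r ∧ m + 3 ≤ r + t) → X.δ r w = y r := by
  induction t with
  | zero =>
    obtain ⟨w, hw⟩ := exists_δ_eq_of_lt hy i le_rfl
    exact ⟨w, fun r hr ↦ hw r (by grind)⟩
  | succ t ih =>
    obtain ⟨w, hw⟩ := ih
    -- In this case all faces above `i` are already matched.
    by_cases hi : m + 2 ≤ i + t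
    · exact ⟨w, fun r hr ↦ hw r (by grind)⟩
    -- The next face, going down from the top, is `j.succ = m + 2 - t`; `X.σ j` is a section of it.
    let j : Fin (m + 2) := ⟨m + 1 - t, by lia⟩
    have hj : i < j.succ := by grind
    refine ⟨w + X.σ j (y j.succ - X.δ j.succ w), fun r hr ↦ ?_⟩
    rw [map_add]
    obtain hrj | hrj | hrj := lt_trichotomy r j.succ
    · obtain ⟨a, rfl⟩ := Fin.exists_castSucc_eq.2 (by grind : r ≠ Fin.last _)
      have hr' : X.δ a.castSucc w = y a.castSucc := hw _ (by grind)
      rw [hr', X.δ_σ_eq_zero_of_lt (by grind)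
        (δ_sub_eq_zero_of_le hy (by grind) (by grind) (by grind) hr'), add_zero]
    · subst hrj
      have h := ConcreteCategory.congr_hom (X.δ_comp_σ_succ (i := j))
        (y j.succ - X.δ j.succ w)
      simp only [ConcreteCategory.comp_apply, ConcreteCategory.id_apply] at h
      rw [h, add_sub_cancel]
    · obtain ⟨a, rfl⟩ := Fin.exists_succ_eq.2 (by grind : r ≠ 0)
      obtain ⟨b, hb⟩ := Fin.exists_castSucc_eq.2 (by grind : j.succ ≠ Fin.last _)
      have hr' : X.δ a.succ w = y a.succ := hw _ (by grind)
      have hz : X.δ a (y j.succ - X.δ j.succ w) = 0 := by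
        rw [← hb]
        exact δ_sub_eq_zero_of_ge hy (by grind) (by grind) (by grind) hr'
      rw [hr', X.δ_σ_eq_zero_of_gt (by grind) hz, add_zero]

/-- Horns of dimension at least two in a simplicial module have fillers. -/
lemma exists_δ_eq : ∃ w : X _⦋m + 2⦌, ∀ r : Fin (m + 3), r ≠ i → X.δ r w = y r := by
  obtain ⟨w, hw⟩ := exists_δ_eq_of_lt_or_gt hy (m + 3)
  exact ⟨w, fun r hr ↦ hw r (by grind)⟩

end HornFilling

end SimplicialObject

end CategoryTheory

open SimplicialObject

/-! ### Kan property and invertibility of edges -/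

section

variable {k : Type u} [CommRing k] (X : SimplicialObject (ModuleCat.{u} k))

/-- The simplicial set underlying a simplicial module is a Kan complex. -/
theorem kanComplex_forgetSMod : SSet.KanComplex ((forgetSMod k).obj X) := by
  rw [SSet.KanComplex.iff]
  intro n i f hf
  obtain _ | m := n
  -- A 1-dimensional horn is a single vertex, filled by its degenerate edge.
  · have hi : ∀ i : Fin 2, i.rev ≠ i := by decide
    refine ⟨SSet.stdSimplex.σ 0 ≫ f i.rev (hi i), fun j hj ↦ ?_⟩
    have hij : ∀ i j : Fin 2, j ≠ i → j = i.rev := by decide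
    obtain rfl := hij i j hj
    rw [← Category.assoc, SSet.stdSimplex.isTerminalObj₀.hom_ext (_ ≫ _) (𝟙 _), Category.id_comp]
  -- The value 0 at the missing face `i` is never used.
  · let y : Fin (m + 3) → X _⦋m + 1⦌ := fun j ↦
      if hj : j ≠ i then SSet.yonedaEquiv (f j hj) else 0
    have hy' (j : Fin (m + 3)) (hj : j ≠ i) : y j = SSet.yonedaEquiv (f j hj) := dif_pos hj
    have hy (a b : Fin (m + 2)) (hab : a ≤ b) (ha : a.castSucc ≠ i) (hb : b.succ ≠ i) :
        X.δ b (y a.castSucc) = X.δ a (y b.succ) := by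
      have h := congrArg SSet.yonedaEquiv (hf a.castSucc b.succ ha hb (Fin.castSucc_lt_succ_iff.2 hab))
      rw [hy' _ ha, hy' _ hb]
      rw [SSet.stdSimplex.yonedaEquiv_δ_comp, SSet.stdSimplex.yonedaEquiv_δ_comp] at h
      exact h
    obtain ⟨w, hw⟩ := exists_δ_eq hy
    refine ⟨SSet.yonedaEquiv.symm w, fun j hj ↦ ?_⟩
    refine (SSet.stdSimplex.δ_comp_yonedaEquiv_symm (X := (forgetSMod k).obj X) w j).trans ?_
    rw [Equiv.symm_apply_eq, ← hy' j hj]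
    exact hw j hj

/-- Every edge of a simplicial module has an inverse up to homotopy. -/
lemma exists_compStruct_forgetSMod {x₀ x₁ : ((forgetSMod k).obj X) _⦋0⦌}
    (e : SSet.Edge x₀ x₁) :
    ∃ e' : SSet.Edge x₁ x₀, Nonempty (SSet.Edge.CompStruct e e' (.id x₀)) := by
  let v₀ : X _⦋0⦌ := x₀
  let v₁ : X _⦋0⦌ := x₁
  let s : X _⦋1⦌ := e.edge
  have hs₁ : X.δ 1 s = v₀ := e.src_eq
  have hs₀ : X.δ 0 s = v₁ := e.tgt_eq
  have h₀ (v : X _⦋0⦌) : X.δ 0 (X.σ 0 v) = v :=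
    ConcreteCategory.congr_hom (X.δ_comp_σ_self (i := (0 : Fin 1))) v
  have h₁ (v : X _⦋0⦌) : X.δ 1 (X.σ 0 v) = v :=
    ConcreteCategory.congr_hom (X.δ_comp_σ_succ (i := (0 : Fin 1))) v
  have h₀₀ (v : X _⦋1⦌) : X.δ 0 (X.σ 0 v) = v :=
    ConcreteCategory.congr_hom (X.δ_comp_σ_self (i := (0 : Fin 2))) v
  have h₁₀ (v : X _⦋1⦌) : X.δ 1 (X.σ 0 v) = v :=
    ConcreteCategory.congr_hom (X.δ_comp_σ_succ (i := (0 : Fin 2))) v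
  have h₁₁ (v : X _⦋1⦌) : X.δ 1 (X.σ 1 v) = v :=
    ConcreteCategory.congr_hom (X.δ_comp_σ_self (i := (1 : Fin 2))) v
  have h₂₁ (v : X _⦋1⦌) : X.δ 2 (X.σ 1 v) = v :=
    ConcreteCategory.congr_hom (X.δ_comp_σ_succ (i := (1 : Fin 2))) v
  have h₀₁ (v : X _⦋1⦌) : X.δ 0 (X.σ 1 v) = X.σ 0 (X.δ 0 v) :=
    ConcreteCategory.congr_hom (X.δ_comp_σ_of_le (i := (0 : Fin 2)) (j := (0 : Fin 1)) le_rfl) v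
  have h₂₀ (v : X _⦋1⦌) : X.δ 2 (X.σ 0 v) = X.σ 0 (X.δ 1 v) :=
    ConcreteCategory.congr_hom
      (X.δ_comp_σ_of_gt (i := (1 : Fin 2)) (j := (0 : Fin 1)) Fin.zero_lt_one) v
  -- `-s`, corrected by degenerate edges so that its endpoints are those of `s` swapped.
  let s' : X _⦋1⦌ := X.σ 0 v₀ + X.σ 0 v₁ - s
  have hs'₁ : X.δ 1 s' = v₁ := by simp [s', h₁, hs₁]
  have hs'₀ : X.δ 0 s' = v₀ := by simp [s', h₀, hs₀]
  let t : X _⦋2⦌ := X.σ 1 s - X.σ 0 s + X.σ 0 (X.σ 0 v₀)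
  have ht₀ : X.δ 0 t = s' := by simp only [t, s', map_add, map_sub, h₀₁, h₀₀, hs₀]; abel
  have ht₁ : X.δ 1 t = X.σ 0 v₀ := by simp [t, h₁₁, h₁₀]
  have ht₂ : X.δ 2 t = s := by simp [t, h₂₁, h₂₀, hs₁, h₁]
  exact ⟨.mk (X := (forgetSMod k).obj X) s' hs'₁ hs'₀,
    ⟨.mk (X := (forgetSMod k).obj X) t ht₂ ht₀ ht₁⟩⟩

/-- The homotopy category of a simplicial module is a groupoid. -/
theorem isGroupoid_hoFunctor_forgetSMod :
    IsGroupoid (SSet.hoFunctor.{u}.obj ((forgetSMod k).obj X)) := by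
  let V := (SSet.truncation 2).obj ((forgetSMod k).obj X)
  have inv {x y : V.obj (op ⟨⦋0⦌, by simp⟩)} (e : SSet.Truncated.Edge x y) :
      ∃ e' : SSet.Truncated.Edge y x, SSet.Truncated.HomotopyCategory.homMk e ≫
        SSet.Truncated.HomotopyCategory.homMk e' = 𝟙 _ := by
    obtain ⟨e', ⟨h⟩⟩ := exists_compStruct_forgetSMod X (SSet.Edge.ofTruncated e)
    refine ⟨e'.toTruncated, ?_⟩
    rw [← SSet.Truncated.HomotopyCategory.homMk_id]
    exact SSet.Truncated.HomotopyCategory.homMk_comp_homMk h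
  -- Edges generate the homotopy category, so only their classes need inverses. A right inverse
  -- which itself has a right inverse is two-sided.
  refine (isGroupoid_iff_isomorphisms_eq_top V.HomotopyCategory).2
    (SSet.Truncated.HomotopyCategory.morphismProperty_eq_top fun e ↦ ?_)
  obtain ⟨e', h⟩ := inv e
  obtain ⟨e'', h'⟩ := inv e'
  refine ⟨_, h, ?_⟩
  have he : SSet.Truncated.HomotopyCategory.homMk e =
      SSet.Truncated.HomotopyCategory.homMk e'' := by
    rw [← Category.comp_id (SSet.Truncated.HomotopyCategory.homMk e), ← h', ← Category.assoc, h,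
      Category.id_comp]
  rw [he, h']

end

/-! ### Linear groupoids and the counterexamples -/

section

variable {k : Type u} [CommRing k]

/-- A `k`-linear category is a groupoid if and only if all its hom-modules are zero. -/
theorem isGroupoid_forgetKCat_iff (C : KCat.{u} k) :
    IsGroupoid ((forgetKCat k).obj C) ↔ ∀ A B : C.Obj, Subsingleton (A ⟶ B) := by
  constructor
  · intro (h : IsGroupoid C.Obj) A B
    -- In a groupoid the zero endomorphism is a monomorphism.
    have hA : 𝟙 A = 0 := by
      rw [← cancel_mono (0 : A ⟶ A), Limits.comp_zero, Limits.comp_zero]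
    refine ⟨fun f g ↦ ?_⟩
    rw [← Category.id_comp f, ← Category.id_comp g, hA, Limits.zero_comp, Limits.zero_comp]
  · intro h
    exact { all_isIso := fun {A B} f ↦
      ⟨(0 : (show C.Obj from B) ⟶ (show C.Obj from A)), (h A A).elim _ _, (h B B).elim _ _⟩ }

/-- The homotopy category of the nerve of a category is equivalent to that category. -/
noncomputable def hoNerveEquivalence (C : Cat.{u, u}) :
    SSet.hoFunctor.{u}.obj (nerveFunctor.{u, u}.obj C) ≌ C :=
  Cat.equivOfIso (nerveFunctorCompHoFunctorIso.{u}.app C)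

/-- If the homotopy category of a simplicial module is equivalent to that of the nerve of a
linear category, then the latter category is a groupoid. -/
theorem isGroupoid_of_hoFunctor_equivalence (C : KCat.{u} k) (X : SimplicialObject (ModuleCat.{u} k))
    (E : SSet.hoFunctor.{u}.obj ((forgetSMod k).obj X) ≌
      SSet.hoFunctor.{u}.obj (nerveFunctor.{u, u}.obj ((forgetKCat k).obj C))) :
    IsGroupoid ((forgetKCat k).obj C) :=
  have := isGroupoid_hoFunctor_forgetSMod X
  isGroupoid_of_reflects_iso (E.trans (hoNerveEquivalence _)).inverse

variable (k)

/-- The empty `k`-linear category. -/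
def KCat.empty : KCat.{u} k where
  Obj := Discrete PEmpty.{u + 1}
  preadditive :=
    { homGroup := fun A ↦ A.as.elim
      add_comp := fun A ↦ A.as.elim
      comp_add := fun A ↦ A.as.elim }
  linear :=
    letI : Preadditive (Discrete PEmpty.{u + 1}) := _
    { homModule := fun A ↦ A.as.elim
      smul_comp := fun A ↦ A.as.elim
      comp_smul := fun A ↦ A.as.elim }

/-- The ring `k`, seen as a linear category with one object. -/
def KCat.one : KCat.{u} k :=
  letI : Linear k (SingleObj k) :=
    { homModule := fun _ _ ↦ inferInstanceAs (Module k k)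
      smul_comp := fun _ _ _ r f g ↦ mul_smul_comm r (show k from g) (show k from f)
      comp_smul := fun _ _ _ f r g ↦ smul_mul_assoc r (show k from g) (show k from f) }
  -- `SingleObj k` has its object in `Type`; inducing along `PUnit` moves it to universe `u`.
  { Obj := InducedCategory (SingleObj k) fun _ : PUnit.{u + 1} ↦ SingleObj.star k }

/-- For each functor from linear categories to simplicial modules there is a linear category at
which it is not compatible with the nerve, even up to equivalence of homotopy categories. -/
theorem exists_isEmpty_hoFunctor_equivalence (N : KCat.{u} k ⥤ SimplicialObject (ModuleCat.{u} k)) :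
    ∃ C : KCat.{u} k, (Nontrivial k → Nonempty C.Obj) ∧
      IsEmpty (SSet.hoFunctor.{u}.obj ((forgetSMod k).obj (N.obj C)) ≌
        SSet.hoFunctor.{u}.obj (nerveFunctor.{u, u}.obj ((forgetKCat k).obj C))) := by
  obtain h | h := subsingleton_or_nontrivial k
  · refine ⟨KCat.empty k, fun _ ↦ (not_nontrivial k ‹_›).elim, ⟨fun E ↦ ?_⟩⟩
    let x : SSet.hoFunctor.{u}.obj ((forgetSMod k).obj (N.obj (KCat.empty k))) :=
      (SSet.hoFunctor.obj.equiv _).symm (0 : (N.obj (KCat.empty k)) _⦋0⦌)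
    exact ((E.trans (hoNerveEquivalence _)).functor.obj x).as.elim
  · refine ⟨KCat.one k, fun _ ↦ ⟨PUnit.unit⟩, ⟨fun E ↦ ?_⟩⟩
    have := (isGroupoid_forgetKCat_iff _).1 (isGroupoid_of_hoFunctor_equivalence _ _ E)
      PUnit.unit PUnit.unit
    have h01 := congrArg InducedCategory.Hom.hom (this.elim ⟨(0 : k)⟩ ⟨(1 : k)⟩)
    exact zero_ne_one (α := k) h01

end

theorem mainTheorem8 (k : Type u) [CommRing k] :
    -- no functor makes the square with the classical nerve commute up to natural isomorphism
    (∀ N : KCat.{u} k ⥤ SimplicialObject (ModuleCat.{u} k),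
      IsEmpty (N ⋙ forgetSMod k ≅ forgetKCat k ⋙ nerveFunctor.{u, u})) ∧
    -- nor does it commute up to natural isomorphism after applying the homotopy category functor
    (∀ N : KCat.{u} k ⥤ SimplicialObject (ModuleCat.{u} k),
      IsEmpty (N ⋙ forgetSMod k ⋙ SSet.hoFunctor.{u} ≅
        forgetKCat k ⋙ nerveFunctor.{u, u} ⋙ SSet.hoFunctor.{u})) ∧
    -- nor even up to objectwise equivalences of categories
    (∀ N : KCat.{u} k ⥤ SimplicialObject (ModuleCat.{u} k),
      ∃ C : KCat.{u} k, (Nontrivial k → Nonempty C.Obj) ∧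
        IsEmpty (SSet.hoFunctor.{u}.obj ((forgetSMod k).obj (N.obj C)) ≌
          SSet.hoFunctor.{u}.obj (nerveFunctor.{u, u}.obj ((forgetKCat k).obj C)))) ∧
    -- simplicial modules are Kan complexes
    (∀ X : SimplicialObject (ModuleCat.{u} k), SSet.KanComplex ((forgetSMod k).obj X)) ∧
    -- so compatibility at `C` forces the category underlying `C` to be a groupoid
    (∀ (C : KCat.{u} k) (X : SimplicialObject (ModuleCat.{u} k)),
      Nonempty (SSet.hoFunctor.{u}.obj ((forgetSMod k).obj X) ≌
          SSet.hoFunctor.{u}.obj (nerveFunctor.{u, u}.obj ((forgetKCat k).obj C))) →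
        IsGroupoid ((forgetKCat k).obj C)) ∧
    -- which happens only if `C` is trivial, in the sense that all its hom-modules are zero
    (∀ C : KCat.{u} k,
      IsGroupoid ((forgetKCat k).obj C) ↔ ∀ A B : C.Obj, Subsingleton (A ⟶ B)) := by
  have hN := exists_isEmpty_hoFunctor_equivalence k
  have hho (N : KCat.{u} k ⥤ SimplicialObject (ModuleCat.{u} k)) :
      IsEmpty (N ⋙ forgetSMod k ⋙ SSet.hoFunctor.{u} ≅
        forgetKCat k ⋙ nerveFunctor.{u, u} ⋙ SSet.hoFunctor.{u}) := by
    obtain ⟨C, _, hC⟩ := hN N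
    exact ⟨fun e ↦ hC.false (Cat.equivOfIso (e.app C))⟩
  exact ⟨fun N ↦ ⟨fun e ↦ (hho N).false (Functor.isoWhiskerRight e SSet.hoFunctor.{u})⟩, hho, hN,
    kanComplex_forgetSMod, fun C X ⟨E⟩ ↦ isGroupoid_of_hoFunctor_equivalence C X E,
    isGroupoid_forgetKCat_iff⟩
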